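/- Let $S$ (measured system) and $M$ (memory) be finite-dimensional quantum systems with Hamiltonians $H_S,H_M$, let $\beta=1/(k_BT)>0$, and write $S(\rho)=-\mathrm{tr}[\rho\ln\rho]$ and $F_X(\rho)=\mathrm{tr}[H_X\rho]-\beta^{-1}S(\rho)$ for $X\in\{S,M\}$. Let a general quantum measurement on $S$ with finitely many outcomes $k$ be given by Kraus operators $M_{ki}$, $\sum_{k,i}M_{ki}^\dagger M_{ki}=1$, and put $T_k(\rho)=\sum_iM_{ki}\rho M_{ki}^\dagger$. Let $(\rho_M,U_{SM},\{Q_k\})$ be any implementation of it: $\rho_M$ is a state of $M$, $U_{SM}$ is unitary, and $Q_k$ are orthogonal projections on $M$ with $\sum_kQ_k=1$ and $[Q_k,H_M]=0$, such that $$\mathrm{tr}_M\big[(1\otimes Q_k)U_{SM}(\rho\otimes\rho_M)U_{SM}^\dagger(1\otimes Q_k)\big]=T_k(\rho)\quad\text{for all } k \text{ and all states }\rho\text{ of }S.$$ For an initial state $\rho_S$ of $S$ let $\rho_S'=\sum_kT_k(\rho_S)$ and $\rho'_M=\mathrm{tr}_S\big[\sum_k(1\otimes Q_k)U_{SM}(\rho_S\otimes\rho_M)U_{SM}^\dagger(1\otimes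 Q_k)\big]$ be the average states after the measurement step, and let $\Delta F_S=F_S(\rho'_S)-F_S(\rho_S)$ and $\Delta F_M=F_M(\rho'_M)-F_M(\rho_M)$. A unitary $U$ acting on a system with Hamiltonian $H$ in the state $\rho$ costs the work $\mathrm{tr}[H(U\rho U^\dagger-\rho)]$. Then the following hold. (i) The work $W_{\mathcal M}$ of $U_{SM}$ on $\rho_S\otimes\rho_M$ (with Hamiltonian $H_S\otimes1+1\otimes H_M$) equals the energy cost $\Delta E_{\mathcal M}=\mathrm{tr}[H_S(\rho'_S-\rho_S)]+\mathrm{tr}[H_M(\rho'_M-\rho_M)]$ of the measurement step. (ii) (Second Law for the measurement.) Let $W_{\mathcal R}$ be either the work of a unitary on $M$ (in state $\rho'_M$) and a finite-dimensional bath, initially thermal at inverse temperature $\beta$, that returns $M$ to $\rho_M$; or a limit of works of such unitaries whose final memory states converge to $\rho_M$ (the bath may vary along the sequence); or the ideal reset cost $-\Delta F_M$. Then $W_{\rm cost}:=W_{\mathcal M}+W_{\mathcal R}$ satisfies $$W_{\rm cost}\ \ge\ \Delta F_S .$$ (iii) (No net work from a full cycle.) Let in addition $W_{\rm res}$ be either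 the average work of restoring $S$ to $\rho_S$ after the measurement by unitaries on $S$ and a finite-dimensional bath, initially thermal at inverse temperature $\beta$, where the unitary $V_k$ may depend on the outcome $k$ and the average final state of $S$ is $\rho_S$; or a limit of such works for processes (the bath may vary) whose average final states converge to $\rho_S$; or the ideal restoring cost $-\Delta F_S$. Then $$W_{\rm cost}+W_{\rm res}\ \ge\ 0 .$$ -/

import Mathlib

open scoped Matrix Kronecker ComplexOrder

noncomputable section

/-! Finite-dimensional quantum systems are described in orthonormal bases: operators on a system
with basis index set `a` are matrices `Matrix a a ℂ`, and the joint system of `a` and `b` has basis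
index set `a × b`. -/

namespace QMeas

variable {s m a b κ : Type*} [Fintype s] [DecidableEq s] [Fintype m] [DecidableEq m]
  [Fintype a] [DecidableEq a] [Fintype b] [DecidableEq b] [Fintype κ]

/-- Quantum states (density matrices): positive semidefinite with unit trace. -/
structure IsState (ρ : Matrix a a ℂ) : Prop where
  posSemidef : ρ.PosSemidef
  trace_eq_one : ρ.trace = 1

/-- Partial trace over the second tensor factor. -/
def trSnd (X : Matrix (a × b) (a × b) ℂ) : Matrix a a ℂ :=
  Matrix.of fun i j => ∑ k, X (i, k) (j, k)

/-- Partial trace over the first tensor factor. -/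
def trFst (X : Matrix (a × b) (a × b) ℂ) : Matrix b b ℂ :=
  Matrix.of fun i j => ∑ k, X (k, i) (k, j)

/-- The expectation value `tr[H X]` (a real number when `H` and `X` are Hermitian). -/
def expect (H X : Matrix a a ℂ) : ℝ := (H * X).trace.re

/-- The von Neumann entropy `S(ρ) = -tr[ρ ln ρ]`, with `ln` applied through the functional calculus.
Since `Real.log 0 = 0` in Mathlib, the convention `0 ln 0 = 0` holds. -/
def entropy (ρ : Matrix a a ℂ) : ℝ := -(ρ * cfc Real.log ρ).trace.re

/-- The free energy `F(ρ) = tr[H ρ] - S(ρ) / β` with respect to the Hamiltonian `H`. -/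
def freeEnergy (β : ℝ) (H ρ : Matrix a a ℂ) : ℝ := expect H ρ - entropy ρ / β

/-- The Hamiltonian `H₁ ⊗ 1 + 1 ⊗ H₂` of two systems. -/
def jointH (H₁ : Matrix a a ℂ) (H₂ : Matrix b b ℂ) : Matrix (a × b) (a × b) ℂ :=
  H₁ ⊗ₖ (1 : Matrix b b ℂ) + (1 : Matrix a a ℂ) ⊗ₖ H₂

/-- The thermal state `exp(-β H) / tr[exp(-β H)]`. -/
def thermal (β : ℝ) (H : Matrix a a ℂ) : Matrix a a ℂ :=
  (NormedSpace.exp (-(β : ℂ) • H)).trace⁻¹ • NormedSpace.exp (-(β : ℂ) • H)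

/-- The state `U ρ U†` after the unitary `U`. -/
def evolve (U ρ : Matrix a a ℂ) : Matrix a a ℂ := U * ρ * Uᴴ

/-- The work `W = tr[H (U ρ U† - ρ)]` needed to drive a system with Hamiltonian `H`
from `ρ` by the unitary `U`. -/
def unitaryWork (H U ρ : Matrix a a ℂ) : ℝ := expect H (evolve U ρ - ρ)

/-- A general quantum measurement (quantum instrument) on `s` with outcomes `k : κ`, given by Kraus
operators `M_{ki}` with `∑_{k,i} M_{ki}† M_{ki} = 1`. -/
structure Measurement (s κ : Type*) [Fintype s] [DecidableEq s] [Fintype κ] where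
  /-- number of Kraus operators belonging to outcome `k` -/
  num : κ → ℕ
  /-- the Kraus operators `M_{ki}` -/
  kraus : (k : κ) → Fin (num k) → Matrix s s ℂ
  complete : ∑ k, ∑ i, (kraus k i)ᴴ * kraus k i = 1

namespace Measurement

/-- The operation `T_k(ρ) = ∑_i M_{ki} ρ M_{ki}†`. It equals `p_k ρ'_{S,k}`: the outcome probability
`p_k = tr[T_k(ρ)]` times the post-measurement state for outcome `k`. -/
def op (T : Measurement s κ) (k : κ) (ρ : Matrix s s ℂ) : Matrix s s ℂ :=
  ∑ i, T.kraus k i * ρ * (T.kraus k i)ᴴ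

/-- The average post-measurement state `ρ'_S = ∑_k p_k ρ'_{S,k} = ∑_k T_k(ρ)`. -/
def post (T : Measurement s κ) (ρ : Matrix s s ℂ) : Matrix s s ℂ := ∑ k, T.op k ρ

end Measurement

/-- A measurement device `(ρ_M, U_SM, {Q_k})` for the system `s` with memory `m`: an initial memory
state, a unitary on system and memory, and orthogonal projections `Q_k` on the memory that sum to
the identity. -/
structure Device (s m κ : Type*) [Fintype s] [DecidableEq s] [Fintype m] [DecidableEq m]
    [Fintype κ] where
  /-- initial memory state `ρ_M` -/
  mem : Matrix m m ℂ
  /-- interaction `U_SM` -/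
  U : Matrix (s × m) (s × m) ℂ
  /-- readout projections `Q_k` -/
  Q : κ → Matrix m m ℂ
  mem_state : IsState mem
  unitary : U ∈ Matrix.unitaryGroup (s × m) ℂ
  Q_herm : ∀ k, (Q k).IsHermitian
  Q_idem : ∀ k, Q k * Q k = Q k
  Q_sum : ∑ k, Q k = 1

namespace Device

/-- The unnormalised joint state
`p_k ρ'_{SM,k} = (1 ⊗ Q_k) U_SM (ρ_S ⊗ ρ_M) U_SM† (1 ⊗ Q_k)` for outcome `k`. -/
def branch (D : Device s m κ) (ρ : Matrix s s ℂ) (k : κ) : Matrix (s × m) (s × m) ℂ :=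
  ((1 : Matrix s s ℂ) ⊗ₖ D.Q k) * evolve D.U (ρ ⊗ₖ D.mem) * ((1 : Matrix s s ℂ) ⊗ₖ D.Q k)

/-- The joint state `ρ'_SM = ∑_k p_k ρ'_{SM,k}` after the measurement step. -/
def postJoint (D : Device s m κ) (ρ : Matrix s s ℂ) : Matrix (s × m) (s × m) ℂ :=
  ∑ k, D.branch ρ k

/-- The memory state `ρ'_M` after the measurement step. -/
def postMem (D : Device s m κ) (ρ : Matrix s s ℂ) : Matrix m m ℂ := trFst (D.postJoint ρ)

/-- The device implements the measurement `T`: on every input state it gives each outcome with the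
correct probability and the correct post-measurement state (both are contained in the equality of
the unnormalised states). -/
def Implements (D : Device s m κ) (T : Measurement s κ) : Prop :=
  ∀ ρ : Matrix s s ℂ, IsState ρ → ∀ k, trSnd (D.branch ρ k) = T.op k ρ

end Device

/-- The energy cost `ΔE_M = ΔE_S + tr[H_M (ρ'_M - ρ_M)]` of the measurement step, with
`ΔE_S = tr[H_S (ρ'_S - ρ_S)]`. -/
def measEnergy (HS : Matrix s s ℂ) (HM : Matrix m m ℂ) (T : Measurement s κ) (D : Device s m κ)
    (ρ : Matrix s s ℂ) : ℝ :=
  expect HS (T.post ρ - ρ) + expect HM (D.postMem ρ - D.mem)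

/-- The work `tr[H_SM (U_SM (ρ_S ⊗ ρ_M) U_SM† - ρ_S ⊗ ρ_M)]` of the measurement unitary. -/
def measWork (HS : Matrix s s ℂ) (HM : Matrix m m ℂ) (D : Device s m κ) (ρ : Matrix s s ℂ) : ℝ :=
  unitaryWork (jointH HS HM) D.U (ρ ⊗ₖ D.mem)

/-- Free energy change `ΔF_M = F(ρ'_M) - F(ρ_M)` of the memory in the measurement step. -/
def deltaFM (β : ℝ) (HM : Matrix m m ℂ) (D : Device s m κ) (ρ : Matrix s s ℂ) : ℝ :=
  freeEnergy β HM (D.postMem ρ) - freeEnergy β HM D.mem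

/-- Free energy change `ΔF_S = F(ρ'_S) - F(ρ_S)` of the system in the measurement. -/
def deltaFS (β : ℝ) (HS : Matrix s s ℂ) (T : Measurement s κ) (ρ : Matrix s s ℂ) : ℝ :=
  freeEnergy β HS (T.post ρ) - freeEnergy β HS ρ

/-- `w` is a work cost of resetting the memory. A resetting process is a unitary on the memory
(in state `ρ'_M`) and a finite-dimensional bath that is initially thermal at inverse temperature
`β`. As baths of any dimension are allowed and many resets can only be approached, `w` may be a limit
of work costs of processes whose final memory state tends to `ρ_M`; in particular `w` may be the
work cost of a process that ends exactly in `ρ_M`. -/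
def IsResetWork (β : ℝ) (HM : Matrix m m ℂ) (D : Device s m κ) (ρ : Matrix s s ℂ) (w : ℝ) : Prop :=
  ∀ ε : ℝ, 0 < ε → ∃ (n : ℕ) (HB : Matrix (Fin (n + 1)) (Fin (n + 1)) ℂ)
    (U : Matrix (m × Fin (n + 1)) (m × Fin (n + 1)) ℂ),
    HB.IsHermitian ∧ U ∈ Matrix.unitaryGroup (m × Fin (n + 1)) ℂ ∧
    (∀ i j, ‖trSnd (evolve U (D.postMem ρ ⊗ₖ thermal β HB)) i j - D.mem i j‖ < ε) ∧
    |unitaryWork (jointH HM HB) U (D.postMem ρ ⊗ₖ thermal β HB) - w| < ε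

/-- `w` is an (average) work cost of restoring the measured system to its initial state `ρ`, after
the measurement, with a thermal bath at inverse temperature `β`. The unitary `V k` on system and bath
may depend on the outcome `k` (feedback); restoring without feedback is the case of a constant `V`.
As `T_k(ρ) = p_k ρ'_{S,k}`, the sums over `k` are averages over the outcomes. Limits are
allowed as in `IsResetWork`. -/
def IsRestoreWork (β : ℝ) (HS : Matrix s s ℂ) (T : Measurement s κ) (ρ : Matrix s s ℂ) (w : ℝ) :
    Prop :=
  ∀ ε : ℝ, 0 < ε → ∃ (n : ℕ) (HB : Matrix (Fin (n + 1)) (Fin (n + 1)) ℂ)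
    (V : κ → Matrix (s × Fin (n + 1)) (s × Fin (n + 1)) ℂ),
    HB.IsHermitian ∧ (∀ k, V k ∈ Matrix.unitaryGroup (s × Fin (n + 1)) ℂ) ∧
    (∀ i j, ‖(∑ k, trSnd (evolve (V k) (T.op k ρ ⊗ₖ thermal β HB))) i j - ρ i j‖ < ε) ∧
    |∑ k, unitaryWork (jointH HS HB) (V k) (T.op k ρ ⊗ₖ thermal β HB) - w| < ε

end QMeas

end

/-!
The proof rests on the Gibbs variational principle for the von Neumann entropy. For every Hermitian
"test operator" `A` one has `S(ρ) ≤ ln tr exp(A) - tr[A ρ]` (`entropy_le`), and `A = ln(ρ + t)` with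
small `t > 0` comes arbitrarily close to equality (`exists_le_entropy`). So the entropy is an infimum
of affine functions of the state, and states with a kernel need no separate treatment. The facts
about entropy that are needed follow by choosing test operators: subadditivity
(`entropy_subadditive`), its increase under a projective measurement (`entropy_le_pinching`), the
minimality of the free energy of the thermal state (`freeEnergy_thermal_le`), and the lower
semicontinuity of the free energy (`exists_freeEnergy_gt`), which handles limits of processes.

The projective readout costs no energy on average, because the projections commute with the
Hamiltonian of the memory; this gives the work of the measurement step. Resetting the memory costs at
least `-ΔF_M`, so that the total cost is at least `ΔE_S + ΔS_M / β`. The unitary preserves the joint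
entropy, the readout does not decrease it, and subadditivity gives `ΔS_S + ΔS_M ≥ 0`, hence the
Second Law.

In the full cycle the feedback `V_k` can profit from the outcome, and `-ΔF_S` is not a lower bound for
the restoring work. Feedback is, however, the single unitary `∑_k V_k ⊗ Q_k` on system, bath and
memory, applied to the joint state after the readout, and it leaves the memory marginal unchanged.
Subadditivity of the final state (`Device.entropy_add_le_feedback`) then bounds the restoring work
below by `-ΔE_S - ΔS_M / β` (`le_of_isRestoreWork`), which cancels the bound for the total cost.
-/

open scoped Matrix Kronecker ComplexOrder

set_option linter.unusedSectionVars false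

namespace QMeas

variable {a b : Type*} [Fintype a] [DecidableEq a] [Fintype b] [DecidableEq b]

/-! ### Spectral sums -/

/-- The trace `tr f(A)` of a real function of a Hermitian matrix, as a real number. -/
noncomputable def spectralTrace (f : ℝ → ℝ) (A : Matrix a a ℂ) : ℝ := (cfc f A).trace.re

/-- The partition function `tr exp(A)`. -/
noncomputable def partitionFn (A : Matrix a a ℂ) : ℝ := spectralTrace Real.exp A

/-- The diagonal matrix with real entries `d`. -/
def rdiag (d : a → ℝ) : Matrix a a ℂ := Matrix.diagonal fun i => (d i : ℂ)

lemma mul_conjTranspose_of_unitary {U : Matrix a a ℂ} (hU : U ∈ Matrix.unitaryGroup a ℂ) :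
    U * Uᴴ = 1 := Matrix.mem_unitaryGroup_iff.1 hU

lemma conjTranspose_mul_of_unitary {U : Matrix a a ℂ} (hU : U ∈ Matrix.unitaryGroup a ℂ) :
    Uᴴ * U = 1 := Matrix.mem_unitaryGroup_iff'.1 hU

lemma isHermitian_conj_rdiag (U : Matrix a a ℂ) (d : a → ℝ) : (evolve U (rdiag d)).IsHermitian := by
  unfold evolve
  refine Matrix.isHermitian_mul_mul_conjTranspose _ ?_
  unfold rdiag
  rw [Matrix.isHermitian_diagonal_iff]
  intro i
  simp [IsSelfAdjoint]

lemma evolve_cfc_eq {A : Matrix a a ℂ} (hA : A.IsHermitian) (f : ℝ → ℝ) :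
    cfc f A = evolve (hA.eigenvectorUnitary : Matrix a a ℂ) (rdiag fun i => f (hA.eigenvalues i)) := by
  rw [hA.cfc_eq, Matrix.IsHermitian.cfc, Unitary.conjStarAlgAut_apply]
  rfl

lemma eq_evolve_eigenvalues {A : Matrix a a ℂ} (hA : A.IsHermitian) :
    A = evolve (hA.eigenvectorUnitary : Matrix a a ℂ) (rdiag hA.eigenvalues) := by
  conv_lhs => rw [hA.spectral_theorem, Unitary.conjStarAlgAut_apply]
  rfl

lemma trace_evolve {U : Matrix a a ℂ} (hU : U ∈ Matrix.unitaryGroup a ℂ) (X : Matrix a a ℂ) :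
    (evolve U X).trace = X.trace := by
  rw [evolve, Matrix.trace_mul_comm, ← mul_assoc, conjTranspose_mul_of_unitary hU, one_mul]

lemma spectralTrace_eq_sum_eigenvalues (f : ℝ → ℝ) {A : Matrix a a ℂ} (hA : A.IsHermitian) :
    spectralTrace f A = ∑ i, f (hA.eigenvalues i) := by
  rw [spectralTrace, evolve_cfc_eq hA, trace_evolve hA.eigenvectorUnitary.2]
  simp [rdiag, Matrix.trace]

/-- Spectral sums may be computed in any diagonalization, since the characteristic polynomial
determines the multiset of eigenvalues. -/
lemma spectralTrace_evolve_rdiag (f : ℝ → ℝ) {U : Matrix a a ℂ}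
    (hU : U ∈ Matrix.unitaryGroup a ℂ) (d : a → ℝ) :
    spectralTrace f (evolve U (rdiag d)) = ∑ i, f (d i) := by
  have hA := isHermitian_conj_rdiag U d
  rw [spectralTrace_eq_sum_eigenvalues f hA]
  have h1 := hA.roots_charpoly_eq_eigenvalues
  have h2 : (evolve U (rdiag d)).charpoly
      = ∏ i, (Polynomial.X - Polynomial.C (d i : ℂ)) := by
    rw [evolve, Matrix.charpoly_mul_comm, ← mul_assoc, conjTranspose_mul_of_unitary hU, one_mul,
      rdiag, Matrix.charpoly_diagonal]
  have h4 : ∏ i, (Polynomial.X - Polynomial.C (d i : ℂ))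
      = ((Finset.univ.val.map fun i => (d i : ℂ)).map fun z => Polynomial.X - Polynomial.C z).prod := by
    rw [Multiset.map_map]; rfl
  rw [h2, h4, Polynomial.roots_multiset_prod_X_sub_C] at h1
  have h3 := congrArg (fun s : Multiset ℂ => (s.map fun z => f z.re).sum) h1
  simpa [Multiset.map_map] using h3.symm

lemma expect_sub (H X Y : Matrix a a ℂ) : expect H (X - Y) = expect H X - expect H Y := by
  simp [expect, mul_sub]

lemma expect_sum {κ : Type*} (t : Finset κ) (H : Matrix a a ℂ) (X : κ → Matrix a a ℂ) :
    expect H (∑ k ∈ t, X k) = ∑ k ∈ t, expect H (X k) := by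
  simp [expect, Finset.mul_sum, Matrix.trace_sum]

lemma entropy_eq_spectralTrace {ρ : Matrix a a ℂ} (hρ : ρ.IsHermitian) :
    entropy ρ = spectralTrace Real.negMulLog ρ := by
  have h : ρ * cfc Real.log ρ = evolve (hρ.eigenvectorUnitary : Matrix a a ℂ)
      (rdiag fun i => hρ.eigenvalues i * Real.log (hρ.eigenvalues i)) := by
    rw [evolve_cfc_eq hρ]
    conv_lhs => enter [1]; rw [eq_evolve_eigenvalues hρ]
    have hU := conjTranspose_mul_of_unitary hρ.eigenvectorUnitary.2
    generalize (hρ.eigenvectorUnitary : Matrix a a ℂ) = U at hU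
    unfold evolve
    rw [show ∀ D E : Matrix a a ℂ, U * D * Uᴴ * (U * E * Uᴴ) = U * D * (Uᴴ * U) * E * Uᴴ by
      intros; simp only [mul_assoc], hU, mul_one, mul_assoc U]
    simp [rdiag]
  rw [entropy, h, trace_evolve hρ.eigenvectorUnitary.2, spectralTrace_eq_sum_eigenvalues _ hρ]
  simp [rdiag, Matrix.trace, Real.negMulLog]

lemma entropy_evolve_rdiag {U : Matrix a a ℂ} (hU : U ∈ Matrix.unitaryGroup a ℂ) (d : a → ℝ) :
    entropy (evolve U (rdiag d)) = ∑ i, Real.negMulLog (d i) := by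
  rw [entropy_eq_spectralTrace (isHermitian_conj_rdiag U d), spectralTrace_evolve_rdiag _ hU]

lemma evolve_mul (U V X : Matrix a a ℂ) : evolve (U * V) X = evolve U (evolve V X) := by
  simp [evolve, mul_assoc]

lemma entropy_evolve {U : Matrix a a ℂ} (hU : U ∈ Matrix.unitaryGroup a ℂ) {ρ : Matrix a a ℂ}
    (hρ : ρ.IsHermitian) : entropy (evolve U ρ) = entropy ρ := by
  rw [eq_evolve_eigenvalues hρ, ← evolve_mul, entropy_evolve_rdiag hρ.eigenvectorUnitary.2,
    entropy_evolve_rdiag (mul_mem hU hρ.eigenvectorUnitary.2)]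

lemma entropy_submatrix (e : b ≃ a) {ρ : Matrix a a ℂ} (hρ : ρ.IsHermitian) :
    entropy (ρ.submatrix e e) = entropy ρ := by
  have hU := hρ.eigenvectorUnitary.2
  rw [eq_evolve_eigenvalues hρ, entropy_evolve_rdiag hU]
  generalize (hρ.eigenvectorUnitary : Matrix a a ℂ) = U at hU
  have h : (evolve U (rdiag hρ.eigenvalues)).submatrix e e
      = evolve (U.submatrix e e) (rdiag (hρ.eigenvalues ∘ e)) := by
    have : rdiag (hρ.eigenvalues ∘ e) = (rdiag hρ.eigenvalues).submatrix e e := by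
      rw [rdiag, rdiag, Matrix.submatrix_diagonal_equiv]; rfl
    rw [evolve, evolve, this, Matrix.conjTranspose_submatrix, Matrix.submatrix_mul_equiv,
      Matrix.submatrix_mul_equiv]
  rw [h, entropy_evolve_rdiag]
  · exact Equiv.sum_comp e fun i => Real.negMulLog (hρ.eigenvalues i)
  · rw [Matrix.mem_unitaryGroup_iff, Matrix.star_eq_conjTranspose, Matrix.conjTranspose_submatrix,
      Matrix.submatrix_mul_equiv, mul_conjTranspose_of_unitary hU, Matrix.submatrix_one_equiv]

lemma kronecker_mem_unitaryGroup {U : Matrix a a ℂ} {V : Matrix b b ℂ}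
    (hU : U ∈ Matrix.unitaryGroup a ℂ) (hV : V ∈ Matrix.unitaryGroup b ℂ) :
    U ⊗ₖ V ∈ Matrix.unitaryGroup (a × b) ℂ := by
  rw [Matrix.mem_unitaryGroup_iff, Matrix.star_eq_conjTranspose, Matrix.conjTranspose_kronecker,
    ← Matrix.mul_kronecker_mul, mul_conjTranspose_of_unitary hU, mul_conjTranspose_of_unitary hV,
    Matrix.one_kronecker_one]

lemma evolve_kronecker (U X : Matrix a a ℂ) (V Y : Matrix b b ℂ) :
    evolve (U ⊗ₖ V) (X ⊗ₖ Y) = evolve U X ⊗ₖ evolve V Y := by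
  simp only [evolve, Matrix.conjTranspose_kronecker, Matrix.mul_kronecker_mul]

lemma rdiag_kronecker (c : a → ℝ) (d : b → ℝ) :
    rdiag c ⊗ₖ rdiag d = rdiag fun p : a × b => c p.1 * d p.2 := by
  simp [rdiag, Matrix.diagonal_kronecker_diagonal]

lemma trace_eq_sum_of_evolve {U : Matrix a a ℂ} (hU : U ∈ Matrix.unitaryGroup a ℂ) (d : a → ℝ) :
    (evolve U (rdiag d)).trace = ((∑ i, d i : ℝ) : ℂ) := by
  rw [trace_evolve hU]; simp [rdiag, Matrix.trace]

lemma IsState.isHermitian {ρ : Matrix a a ℂ} (hρ : IsState ρ) : ρ.IsHermitian :=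
  hρ.posSemidef.isHermitian

lemma IsState.sum_eigenvalues {ρ : Matrix a a ℂ} (hρ : IsState ρ) :
    ∑ i, hρ.isHermitian.eigenvalues i = 1 := by
  have h := trace_eq_sum_of_evolve hρ.isHermitian.eigenvectorUnitary.2 hρ.isHermitian.eigenvalues
  rw [← eq_evolve_eigenvalues, hρ.trace_eq_one] at h
  exact_mod_cast h.symm

lemma IsState.nonempty {ρ : Matrix a a ℂ} (hρ : IsState ρ) : Nonempty a := by
  by_contra h
  rw [not_nonempty_iff] at h
  simpa using hρ.trace_eq_one

lemma entropy_kronecker {ρ : Matrix a a ℂ} {σ : Matrix b b ℂ} (hρ : IsState ρ) (hσ : IsState σ) :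
    entropy (ρ ⊗ₖ σ) = entropy ρ + entropy σ := by
  have hU := hρ.isHermitian.eigenvectorUnitary.2
  have hV := hσ.isHermitian.eigenvectorUnitary.2
  have h1 := hρ.sum_eigenvalues
  have h2 := hσ.sum_eigenvalues
  rw [eq_evolve_eigenvalues hρ.isHermitian, eq_evolve_eigenvalues hσ.isHermitian,
    ← evolve_kronecker, rdiag_kronecker, entropy_evolve_rdiag hU, entropy_evolve_rdiag hV,
    entropy_evolve_rdiag (kronecker_mem_unitaryGroup hU hV), Fintype.sum_prod_type]
  simp only [Real.negMulLog_mul, Finset.sum_add_distrib, ← Finset.sum_mul, ← Finset.mul_sum, h1, h2]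
  ring

/-! ### The Gibbs variational principle -/

lemma partitionFn_pos [Nonempty a] {A : Matrix a a ℂ} (hA : A.IsHermitian) : 0 < partitionFn A := by
  rw [partitionFn, spectralTrace_eq_sum_eigenvalues _ hA]
  exact Finset.sum_pos (fun _ _ => Real.exp_pos _) Finset.univ_nonempty

lemma jointH_evolve {U C : Matrix a a ℂ} {V D : Matrix b b ℂ} (hU : U ∈ Matrix.unitaryGroup a ℂ)
    (hV : V ∈ Matrix.unitaryGroup b ℂ) :
    jointH (evolve U C) (evolve V D) = evolve (U ⊗ₖ V) (jointH C D) := by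
  have h : ∀ X Y : Matrix (a × b) (a × b) ℂ,
      evolve (U ⊗ₖ V) (X + Y) = evolve (U ⊗ₖ V) X + evolve (U ⊗ₖ V) Y := by
    intro X Y; simp [evolve, mul_add, add_mul]
  rw [jointH, jointH, h, evolve_kronecker, evolve_kronecker]
  simp [evolve, mul_conjTranspose_of_unitary hU, mul_conjTranspose_of_unitary hV]

lemma jointH_rdiag (c : a → ℝ) (d : b → ℝ) :
    jointH (rdiag c) (rdiag d) = rdiag fun p : a × b => c p.1 + d p.2 := by
  rw [jointH, rdiag, rdiag, ← Matrix.diagonal_one, ← Matrix.diagonal_one,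
    Matrix.diagonal_kronecker_diagonal, Matrix.diagonal_kronecker_diagonal, Matrix.diagonal_add]
  simp [rdiag]

lemma jointH_isHermitian {A : Matrix a a ℂ} {B : Matrix b b ℂ} (hA : A.IsHermitian)
    (hB : B.IsHermitian) : (jointH A B).IsHermitian := by
  simp only [jointH, Matrix.IsHermitian, Matrix.conjTranspose_add, Matrix.conjTranspose_kronecker,
    Matrix.conjTranspose_one, hA.eq, hB.eq]

lemma partitionFn_jointH {A : Matrix a a ℂ} {B : Matrix b b ℂ} (hA : A.IsHermitian)
    (hB : B.IsHermitian) : partitionFn (jointH A B) = partitionFn A * partitionFn B := by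
  have hU := hA.eigenvectorUnitary.2
  have hV := hB.eigenvectorUnitary.2
  rw [eq_evolve_eigenvalues hA, eq_evolve_eigenvalues hB, jointH_evolve hU hV, jointH_rdiag]
  simp only [partitionFn]
  rw [spectralTrace_evolve_rdiag _ hU, spectralTrace_evolve_rdiag _ hV,
    spectralTrace_evolve_rdiag _ (kronecker_mem_unitaryGroup hU hV), Fintype.sum_prod_type,
    Finset.sum_mul_sum]
  simp only [Real.exp_add]

lemma sum_normSq_row {W : Matrix a a ℂ} (hW : W ∈ Matrix.unitaryGroup a ℂ) (i : a) :
    ∑ j, Complex.normSq (W i j) = 1 := by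
  have h := congrFun (congrFun (mul_conjTranspose_of_unitary hW) i) i
  simp only [Matrix.mul_apply, Matrix.conjTranspose_apply, Matrix.one_apply_eq, RCLike.star_def,
    Complex.mul_conj] at h
  exact_mod_cast h

lemma sum_normSq_col {W : Matrix a a ℂ} (hW : W ∈ Matrix.unitaryGroup a ℂ) (j : a) :
    ∑ i, Complex.normSq (W i j) = 1 := by
  have h := congrFun (congrFun (conjTranspose_mul_of_unitary hW) j) j
  simp only [Matrix.mul_apply, Matrix.conjTranspose_apply, Matrix.one_apply_eq, RCLike.star_def,
    mul_comm (starRingEnd ℂ _), Complex.mul_conj] at h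
  exact_mod_cast h

/-- The expectation of one diagonalized matrix in another, through the matrix of overlaps of the
two eigenbases. -/
lemma expect_evolve_rdiag (U V : Matrix a a ℂ) (c d : a → ℝ) :
    expect (evolve V (rdiag c)) (evolve U (rdiag d))
      = ∑ j, ∑ i, c j * Complex.normSq ((Vᴴ * U) j i) * d i := by
  have h : (evolve V (rdiag c) * evolve U (rdiag d)).trace
      = (rdiag c * (Vᴴ * U) * rdiag d * (Vᴴ * U)ᴴ).trace := by
    unfold evolve
    rw [Matrix.conjTranspose_mul, Matrix.conjTranspose_conjTranspose, mul_assoc V, mul_assoc V,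
      Matrix.trace_mul_comm V]
    simp only [mul_assoc]
  rw [expect, h, Matrix.trace, Complex.re_sum]
  refine Finset.sum_congr rfl fun j _ => ?_
  rw [Matrix.diag_apply, Matrix.mul_apply, Complex.re_sum]
  refine Finset.sum_congr rfl fun i _ => ?_
  simp only [rdiag, Matrix.mul_diagonal, Matrix.diagonal_mul, Matrix.conjTranspose_apply,
    RCLike.star_def]
  rw [show ∀ x y z w : ℂ, x * y * z * w = x * z * (y * w) by intros; ring, Complex.mul_conj]
  norm_cast
  ring

/-- The scalar case of the Gibbs inequality, including `l = 0`. -/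
lemma negMulLog_add_le {l c : ℝ} (hl : 0 ≤ l) : Real.negMulLog l + l * c ≤ Real.exp c - l := by
  rcases hl.eq_or_lt with rfl | hl
  · simpa using (Real.exp_pos c).le
  · have h := Real.add_one_le_exp (c - Real.log l)
    rw [Real.exp_sub, Real.exp_log hl, le_div_iff₀ hl] at h
    rw [Real.negMulLog]
    linarith

/-- Gibbs' variational inequality `S(ρ) ≤ ln tr exp(A) - tr[A ρ]`. In the eigenbases of `ρ` and `A`
the squared overlaps form a doubly stochastic matrix, which reduces the claim to the scalar
inequality `negMulLog_add_le`. -/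
theorem entropy_le {ρ A : Matrix a a ℂ} (hρ : IsState ρ) (hA : A.IsHermitian) :
    entropy ρ ≤ Real.log (partitionFn A) - expect A ρ := by
  have := hρ.nonempty
  have hZ := partitionFn_pos hA
  have hU := hρ.isHermitian.eigenvectorUnitary.2
  have hV := hA.eigenvectorUnitary.2
  have hl : ∀ i, 0 ≤ hρ.isHermitian.eigenvalues i := hρ.posSemidef.eigenvalues_nonneg
  have hl1 := hρ.sum_eigenvalues
  have hS : entropy ρ = ∑ i, Real.negMulLog (hρ.isHermitian.eigenvalues i) := by
    rw [entropy_eq_spectralTrace hρ.isHermitian, spectralTrace_eq_sum_eigenvalues]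
  have hE := expect_evolve_rdiag (hρ.isHermitian.eigenvectorUnitary : Matrix a a ℂ)
    (hA.eigenvectorUnitary : Matrix a a ℂ) hA.eigenvalues hρ.isHermitian.eigenvalues
  rw [← eq_evolve_eigenvalues, ← eq_evolve_eigenvalues] at hE
  have hq : ∑ j, Real.exp (hA.eigenvalues j - Real.log (partitionFn A)) = 1 := by
    simp only [Real.exp_sub, Real.exp_log hZ]
    rw [← Finset.sum_div, div_eq_one_iff_eq hZ.ne', partitionFn,
      spectralTrace_eq_sum_eigenvalues _ hA]
  have hW : ((hA.eigenvectorUnitary : Matrix a a ℂ)ᴴ * (hρ.isHermitian.eigenvectorUnitary :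
      Matrix a a ℂ)) ∈ Matrix.unitaryGroup a ℂ :=
    mul_mem (Unitary.star_mem hV) hU
  rw [hS, hE]
  generalize ((hA.eigenvectorUnitary : Matrix a a ℂ)ᴴ * (hρ.isHermitian.eigenvectorUnitary :
      Matrix a a ℂ)) = W at hW
  generalize hρ.isHermitian.eigenvalues = l at *
  generalize hA.eigenvalues = c at *
  generalize Real.log (partitionFn A) = z at *
  -- the scalar inequality compares `l i` with the Gibbs weight `exp (c j - z)`
  have key : ∑ j, ∑ i, Complex.normSq (W j i) * (Real.negMulLog (l i) + l i * (c j - z))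
      ≤ ∑ j, ∑ i, Complex.normSq (W j i) * (Real.exp (c j - z) - l i) :=
    Finset.sum_le_sum fun j _ => Finset.sum_le_sum fun i _ =>
      mul_le_mul_of_nonneg_left (negMulLog_add_le (hl i)) (Complex.normSq_nonneg _)
  have e1 : ∀ g : a → ℝ, ∑ j, ∑ i, Complex.normSq (W j i) * g i = ∑ i, g i := by
    intro g
    rw [Finset.sum_comm]
    simp only [← Finset.sum_mul, sum_normSq_col hW, one_mul]
  have e2 : ∀ g : a → ℝ, ∑ j, ∑ i, Complex.normSq (W j i) * g j = ∑ j, g j := by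
    intro g
    simp only [← Finset.sum_mul, sum_normSq_row hW, one_mul]
  have lhs : ∑ j, ∑ i, Complex.normSq (W j i) * (Real.negMulLog (l i) + l i * (c j - z))
      = ∑ i, Real.negMulLog (l i) + ∑ j, ∑ i, c j * Complex.normSq (W j i) * l i - z := by
    have : ∀ j i, Complex.normSq (W j i) * (Real.negMulLog (l i) + l i * (c j - z))
      = Complex.normSq (W j i) * Real.negMulLog (l i) + c j * Complex.normSq (W j i) * l i
        - Complex.normSq (W j i) * (l i * z) := by intros; ring
    simp only [this, Finset.sum_sub_distrib, Finset.sum_add_distrib, e1]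
    rw [← Finset.sum_mul, hl1, one_mul]
  have rhs : ∑ j, ∑ i, Complex.normSq (W j i) * (Real.exp (c j - z) - l i) = 0 := by
    simp only [mul_sub, Finset.sum_sub_distrib]
    rw [e1, e2 fun j => Real.exp (c j - z), hq, hl1, sub_self]
  linarith

/-- The bound of `entropy_le` is approached, within any `ε`, by `A = ln(ρ + t)` with small `t > 0`;
such an `A` commutes with everything that commutes with `ρ`. The shift by `t` avoids `ln 0`. -/
theorem exists_le_entropy {ρ : Matrix a a ℂ} (hρ : IsState ρ) {ε : ℝ} (hε : 0 < ε) :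
    ∃ A : Matrix a a ℂ, A.IsHermitian ∧ (∀ Q, Commute Q ρ → Commute Q A) ∧
      Real.log (partitionFn A) - expect A ρ ≤ entropy ρ + ε := by
  have := hρ.nonempty
  have hd : (0 : ℝ) < Fintype.card a := by exact_mod_cast Fintype.card_pos
  -- with this `t` the partition function `tr(ρ + t)` equals `1 + ε`
  obtain ⟨t, ht, htε⟩ : ∃ t : ℝ, 0 < t ∧ t * Fintype.card a = ε :=
    ⟨ε / Fintype.card a, by positivity, by field_simp⟩
  have hH := hρ.isHermitian
  have hl : ∀ i, 0 ≤ hH.eigenvalues i := hρ.posSemidef.eigenvalues_nonneg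
  have hU := hH.eigenvectorUnitary.2
  refine ⟨cfc (fun x => Real.log (x + t)) ρ, ?_, fun Q hQ => ?_, ?_⟩
  · rw [evolve_cfc_eq hH]; exact isHermitian_conj_rdiag _ _
  · exact (hQ.symm.cfc_real _).symm
  · have hE : expect (cfc (fun x => Real.log (x + t)) ρ) ρ
        = ∑ i, Real.log (hH.eigenvalues i + t) * hH.eigenvalues i := by
      rw [evolve_cfc_eq hH]
      conv_lhs => enter [2]; rw [eq_evolve_eigenvalues hH]
      rw [expect_evolve_rdiag, conjTranspose_mul_of_unitary hU]
      refine Finset.sum_congr rfl fun j _ => ?_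
      rw [Finset.sum_eq_single j] <;> simp +contextual [eq_comm]
    have hZ : partitionFn (cfc (fun x => Real.log (x + t)) ρ) = 1 + ε := by
      rw [partitionFn, evolve_cfc_eq hH, spectralTrace_evolve_rdiag _ hU]
      have : ∀ i, Real.exp (Real.log (hH.eigenvalues i + t)) = hH.eigenvalues i + t :=
        fun i => Real.exp_log (add_pos_of_nonneg_of_pos (hl i) ht)
      simp only [this, Finset.sum_add_distrib, hρ.sum_eigenvalues]
      simp [← htε, mul_comm]
    have hlog : Real.log (1 + ε) ≤ ε := by
      have := Real.log_le_sub_one_of_pos (show 0 < 1 + ε by linarith); linarith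
    have hsum : ∑ i, hH.eigenvalues i * Real.log (hH.eigenvalues i)
        ≤ ∑ i, Real.log (hH.eigenvalues i + t) * hH.eigenvalues i := by
      refine Finset.sum_le_sum fun i _ => ?_
      rw [mul_comm]
      rcases (hl i).eq_or_lt with h | h
      · simp [← h]
      · exact mul_le_mul_of_nonneg_right (Real.log_le_log h (by linarith)) h.le
    rw [hE, hZ, entropy_eq_spectralTrace hH, spectralTrace_eq_sum_eigenvalues _ hH]
    simp only [Real.negMulLog, neg_mul, Finset.sum_neg_distrib]
    linarith

/-! ### Partial traces and states of composite systems -/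

lemma trSnd_sum {κ : Type*} (t : Finset κ) (X : κ → Matrix (a × b) (a × b) ℂ) :
    trSnd (∑ k ∈ t, X k) = ∑ k ∈ t, trSnd (X k) := by
  ext i j
  simp only [trSnd, Matrix.of_apply, Matrix.sum_apply]
  exact Finset.sum_comm

lemma trFst_sum {κ : Type*} (t : Finset κ) (X : κ → Matrix (a × b) (a × b) ℂ) :
    trFst (∑ k ∈ t, X k) = ∑ k ∈ t, trFst (X k) := by
  ext i j
  simp only [trFst, Matrix.of_apply, Matrix.sum_apply]
  exact Finset.sum_comm

lemma trSnd_kronecker (X : Matrix a a ℂ) (Y : Matrix b b ℂ) : trSnd (X ⊗ₖ Y) = Y.trace • X := by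
  ext i j
  simp [trSnd, Matrix.trace, ← Finset.mul_sum, mul_comm]

lemma trFst_kronecker (X : Matrix a a ℂ) (Y : Matrix b b ℂ) : trFst (X ⊗ₖ Y) = X.trace • Y := by
  ext i j
  simp [trFst, Matrix.trace, ← Finset.sum_mul]

lemma trace_trSnd (X : Matrix (a × b) (a × b) ℂ) : (trSnd X).trace = X.trace := by
  simp [trSnd, Matrix.trace, Fintype.sum_prod_type]

lemma trace_trFst (X : Matrix (a × b) (a × b) ℂ) : (trFst X).trace = X.trace := by
  simp [trFst, Matrix.trace, Fintype.sum_prod_type_right]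

/-- Local operators on the first factor pass through the partial trace over the second. -/
lemma trSnd_mul_mul (A C : Matrix a a ℂ) (X : Matrix (a × b) (a × b) ℂ) :
    trSnd ((A ⊗ₖ (1 : Matrix b b ℂ)) * X * (C ⊗ₖ (1 : Matrix b b ℂ))) = A * trSnd X * C := by
  ext i j
  simp only [trSnd, Matrix.of_apply, Matrix.mul_apply, Fintype.sum_prod_type,
    Matrix.kroneckerMap_apply, Matrix.one_apply, mul_ite, mul_one, mul_zero, ite_mul, zero_mul,
    Finset.sum_ite_eq, Finset.sum_ite_eq', Finset.mem_univ, if_true]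
  rw [Finset.sum_comm]
  refine Finset.sum_congr rfl fun l _ => ?_
  rw [← Finset.sum_mul]
  simp only [Finset.mul_sum]
  rw [Finset.sum_comm]

/-- The partial trace over the first factor is cyclic in operators of that factor. -/
lemma trFst_mul_mul (A C : Matrix a a ℂ) (X : Matrix (a × b) (a × b) ℂ) (h : C * A = 1) :
    trFst ((A ⊗ₖ (1 : Matrix b b ℂ)) * X * (C ⊗ₖ (1 : Matrix b b ℂ))) = trFst X := by
  ext i j
  simp only [trFst, Matrix.of_apply, Matrix.mul_apply, Fintype.sum_prod_type,
    Matrix.kroneckerMap_apply, Matrix.one_apply, mul_ite, mul_one, mul_zero, ite_mul, zero_mul,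
    Finset.sum_ite_eq, Finset.sum_ite_eq', Finset.mem_univ, if_true]
  have hCA : ∀ l l', ∑ k, C l k * A k l' = if l = l' then 1 else 0 := fun l l' => by
    rw [← Matrix.mul_apply, h, Matrix.one_apply]
  calc ∑ k, ∑ l, (∑ l', A k l' * X (l', i) (l, j)) * C l k
      = ∑ l, ∑ l', (∑ k, C l k * A k l') * X (l', i) (l, j) := by
        simp only [Finset.sum_mul]
        rw [Finset.sum_comm]
        refine Finset.sum_congr rfl fun l _ => ?_
        rw [Finset.sum_comm]
        exact Finset.sum_congr rfl fun l' _ => Finset.sum_congr rfl fun k _ => by ring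
    _ = ∑ l, X (l, i) (l, j) := by simp [hCA]

lemma expect_kronecker_one (H : Matrix a a ℂ) (X : Matrix (a × b) (a × b) ℂ) :
    expect (H ⊗ₖ (1 : Matrix b b ℂ)) X = expect H (trSnd X) := by
  have h := trSnd_mul_mul H 1 X
  rw [Matrix.one_kronecker_one, mul_one, mul_one] at h
  rw [expect, expect, ← h, trace_trSnd]

lemma expect_one_kronecker (H : Matrix b b ℂ) (X : Matrix (a × b) (a × b) ℂ) :
    expect ((1 : Matrix a a ℂ) ⊗ₖ H) X = expect H (trFst X) := by
  rw [expect, expect, Matrix.trace, Matrix.trace]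
  simp only [Matrix.diag_apply, Matrix.mul_apply, trFst, Matrix.of_apply, Fintype.sum_prod_type,
    Matrix.kroneckerMap_apply, Matrix.one_apply, ite_mul, one_mul, zero_mul]
  congr 1
  simp only [Finset.mul_sum]
  rw [Finset.sum_comm]
  refine Finset.sum_congr rfl fun i _ => ?_
  conv_rhs => rw [Finset.sum_comm]
  refine Finset.sum_congr rfl fun k _ => ?_
  rw [Finset.sum_comm]
  simp

lemma expect_jointH (H : Matrix a a ℂ) (K : Matrix b b ℂ) (X : Matrix (a × b) (a × b) ℂ) :
    expect (jointH H K) X = expect H (trSnd X) + expect K (trFst X) := by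
  rw [← expect_kronecker_one, ← expect_one_kronecker, jointH]
  simp [expect, add_mul]

lemma IsState.evolve {U ρ : Matrix a a ℂ} (hU : U ∈ Matrix.unitaryGroup a ℂ) (hρ : IsState ρ) :
    IsState (evolve U ρ) :=
  ⟨hρ.posSemidef.mul_mul_conjTranspose_same U, by rw [trace_evolve hU, hρ.trace_eq_one]⟩

lemma IsState.kronecker {ρ : Matrix a a ℂ} {σ : Matrix b b ℂ} (hρ : IsState ρ) (hσ : IsState σ) :
    IsState (ρ ⊗ₖ σ) :=
  ⟨hρ.posSemidef.kronecker hσ.posSemidef, by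
    rw [Matrix.trace_kronecker, hρ.trace_eq_one, hσ.trace_eq_one, one_mul]⟩

lemma IsState.submatrix {ρ : Matrix a a ℂ} (hρ : IsState ρ) (e : b ≃ a) :
    IsState (ρ.submatrix e e) :=
  ⟨hρ.posSemidef.submatrix e, by
    rw [← hρ.trace_eq_one]; exact Equiv.sum_comp e fun i => ρ i i⟩

lemma IsState.trSnd {X : Matrix (a × b) (a × b) ℂ} (hX : IsState X) : IsState (trSnd X) := by
  refine ⟨?_, by rw [trace_trSnd, hX.trace_eq_one]⟩
  have h : QMeas.trSnd X = ∑ k, X.submatrix (fun i => (i, k)) fun i => (i, k) := by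
    ext i j; simp [QMeas.trSnd, Matrix.sum_apply]
  rw [h]
  exact Matrix.posSemidef_sum _ fun k _ => hX.posSemidef.submatrix _

lemma IsState.trFst {X : Matrix (a × b) (a × b) ℂ} (hX : IsState X) : IsState (trFst X) := by
  refine ⟨?_, by rw [trace_trFst, hX.trace_eq_one]⟩
  have h : QMeas.trFst X = ∑ k, X.submatrix (fun i => (k, i)) fun i => (k, i) := by
    ext i j; simp [QMeas.trFst, Matrix.sum_apply]
  rw [h]
  exact Matrix.posSemidef_sum _ fun k _ => hX.posSemidef.submatrix _

/-! ### Entropy inequalities -/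

/-- Subadditivity of the entropy: nearly optimal `A` and `B` for the marginals give the test
operator `A ⊗ 1 + 1 ⊗ B` for the joint state. -/
theorem entropy_subadditive {X : Matrix (a × b) (a × b) ℂ} (hX : IsState X) :
    entropy X ≤ entropy (trSnd X) + entropy (trFst X) := by
  refine le_of_forall_pos_le_add fun ε hε => ?_
  obtain ⟨A, hA, -, hA'⟩ := exists_le_entropy hX.trSnd (half_pos hε)
  obtain ⟨B, hB, -, hB'⟩ := exists_le_entropy hX.trFst (half_pos hε)
  have := hX.trSnd.nonempty
  have := hX.trFst.nonempty
  have h := entropy_le hX (jointH_isHermitian hA hB)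
  rw [partitionFn_jointH hA hB, Real.log_mul (partitionFn_pos hA).ne' (partitionFn_pos hB).ne',
    expect_jointH] at h
  linarith

/-- Self-adjoint idempotents that sum to `1` are mutually orthogonal. -/
lemma mul_eq_zero_of_sum_eq_one {κ : Type*} [Fintype κ] {Q : κ → Matrix a a ℂ}
    (hH : ∀ k, (Q k).IsHermitian) (hI : ∀ k, Q k * Q k = Q k) (hS : ∑ k, Q k = 1) {k l : κ}
    (hkl : k ≠ l) : Q k * Q l = 0 := by
  classical
  have hP : ∀ j, (Q j * Q l)ᴴ * (Q j * Q l) = Q l * Q j * Q l := fun j => by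
    rw [Matrix.conjTranspose_mul, (hH j).eq, (hH l).eq, mul_assoc, ← mul_assoc (Q j) (Q j), hI,
      ← mul_assoc]
  have h1 : ∑ j, Q l * Q j * Q l = Q l := by
    rw [← Finset.sum_mul, ← Finset.mul_sum, hS, mul_one, hI]
  rw [← Finset.add_sum_erase _ _ (Finset.mem_univ l), hI, hI, add_eq_left] at h1
  -- positive semidefinite matrices with vanishing sum have vanishing traces
  have h2 : ∀ j ∈ Finset.univ.erase l, 0 ≤ (Q l * Q j * Q l).trace := fun j _ => by
    rw [← hP]; exact (Matrix.posSemidef_conjTranspose_mul_self _).trace_nonneg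
  have h3 : ∑ j ∈ Finset.univ.erase l, (Q l * Q j * Q l).trace = 0 := by
    rw [← Matrix.trace_sum, h1, Matrix.trace_zero]
  have h4 := (Finset.sum_eq_zero_iff_of_nonneg h2).1 h3 k (by simp [hkl])
  rw [← hP, Matrix.trace_conjTranspose_mul_self_eq_zero_iff] at h4
  exact h4

section Pinching

variable {κ : Type*} [Fintype κ] {P : κ → Matrix a a ℂ}

lemma pinching_expect (hI : ∀ k, P k * P k = P k) (hS : ∑ k, P k = 1) {A : Matrix a a ℂ}
    (hA : ∀ k, Commute (P k) A) (X : Matrix a a ℂ) :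
    expect A (∑ k, P k * X * P k) = expect A X := by
  have h : ∀ k, (A * (P k * X * P k)).trace = (P k * (A * X)).trace := fun k => by
    rw [← mul_assoc, Matrix.trace_mul_comm, ← mul_assoc, ← mul_assoc, (hA k).eq, mul_assoc A, hI,
      ← (hA k).eq, mul_assoc]
  rw [expect, expect, Finset.mul_sum, Matrix.trace_sum]
  simp only [h]
  rw [← Matrix.trace_sum, ← Finset.sum_mul, hS, one_mul]

lemma pinching_isState (hH : ∀ k, (P k).IsHermitian) (hI : ∀ k, P k * P k = P k)
    (hS : ∑ k, P k = 1) {X : Matrix a a ℂ} (hX : IsState X) :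
    IsState (∑ k, P k * X * P k) := by
  refine ⟨Matrix.posSemidef_sum _ fun k _ => ?_, ?_⟩
  · have := hX.posSemidef.mul_mul_conjTranspose_same (P k)
    rwa [(hH k).eq] at this
  · have h : ∀ k, (P k * X * P k).trace = (P k * X).trace := fun k => by
      rw [Matrix.trace_mul_comm, ← mul_assoc, hI]
    rw [Matrix.trace_sum, Finset.sum_congr rfl fun k _ => h k, ← Matrix.trace_sum, ← Finset.sum_mul,
      hS, one_mul, hX.trace_eq_one]

/-- A projective measurement does not decrease the entropy: a test operator for the measured state
commutes with the projections, so it has the same expectation in the original state. -/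
theorem entropy_le_pinching (hH : ∀ k, (P k).IsHermitian) (hI : ∀ k, P k * P k = P k)
    (hS : ∑ k, P k = 1) {X : Matrix a a ℂ} (hX : IsState X) :
    entropy X ≤ entropy (∑ k, P k * X * P k) := by
  have hY := pinching_isState hH hI hS hX
  have hc : ∀ l, Commute (P l) (∑ k, P k * X * P k) := fun l => by
    classical
    have h0 : ∀ k l, k ≠ l → P k * P l = 0 := fun k l => mul_eq_zero_of_sum_eq_one hH hI hS
    rw [Commute, SemiconjBy, Finset.mul_sum, Finset.sum_mul, Finset.sum_eq_single l,
      Finset.sum_eq_single l]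
    · rw [← mul_assoc, ← mul_assoc, hI, mul_assoc (P l * X), hI]
    · intro k _ hk; rw [mul_assoc, h0 k l hk, mul_zero]
    · simp
    · intro k _ hk; rw [← mul_assoc, ← mul_assoc, h0 l k hk.symm, zero_mul, zero_mul]
    · simp
  refine le_of_forall_pos_le_add fun ε hε => ?_
  obtain ⟨A, hA, hcA, hA'⟩ := exists_le_entropy hY hε
  have h := entropy_le hX hA
  rw [pinching_expect hI hS fun k => hcA _ (hc k)] at hA'
  linarith

end Pinching

/-! ### Free energy -/

/-- The free energy is lower semicontinuous in the state: it is, up to any `ε`, bounded below by an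
affine function of the state that is tight at `ρ`. -/
theorem exists_freeEnergy_gt {β : ℝ} (hβ : 0 < β) (H : Matrix a a ℂ) {ρ : Matrix a a ℂ}
    (hρ : IsState ρ) {δ : ℝ} (hδ : 0 < δ) :
    ∃ ε > 0, ∀ σ : Matrix a a ℂ, IsState σ → (∀ i j, ‖σ i j - ρ i j‖ < ε) →
      freeEnergy β H ρ - δ < freeEnergy β H σ := by
  obtain ⟨A, hA, -, hA'⟩ := exists_le_entropy hρ (show 0 < β * (δ / 2) by positivity)
  have hcont : Continuous fun σ : Matrix a a ℂ => expect H σ + expect A σ / β := by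
    unfold expect; fun_prop
  -- the entrywise distance is that of the function space `a → a → ℂ`
  have hcont' : Continuous fun σ : a → a → ℂ =>
      expect H (Matrix.of σ) + expect A (Matrix.of σ) / β := hcont
  obtain ⟨ε, hε, hball⟩ := Metric.continuous_iff.1 hcont' (fun i j => ρ i j) (δ / 2) (half_pos hδ)
  refine ⟨ε, hε, fun σ hσ hclose => ?_⟩
  have h1 : |expect H σ + expect A σ / β - (expect H ρ + expect A ρ / β)| < δ / 2 :=
    hball (fun i j => σ i j) (by
      rw [dist_pi_lt_iff hε]
      intro i
      rw [dist_pi_lt_iff hε]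
      intro j
      rw [dist_eq_norm]
      exact hclose i j)
  rw [abs_lt] at h1
  have h2 := entropy_le hσ hA
  have h3 : entropy σ / β ≤ Real.log (partitionFn A) / β - expect A σ / β := by
    rw [← sub_div]; gcongr
  have h4 : Real.log (partitionFn A) / β - expect A ρ / β ≤ entropy ρ / β + δ / 2 := by
    rw [← sub_div, div_le_iff₀ hβ, add_mul, div_mul_cancel₀ _ hβ.ne']; linarith
  unfold freeEnergy
  linarith [h1.1]

section Thermal

variable {β : ℝ} {H : Matrix a a ℂ}

/-- The thermal state in an eigenbasis of the Hamiltonian. -/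
lemma thermal_eq (hH : H.IsHermitian) :
    thermal β H = evolve (hH.eigenvectorUnitary : Matrix a a ℂ)
      (rdiag fun i => Real.exp (-β * hH.eigenvalues i) / ∑ j, Real.exp (-β * hH.eigenvalues j)) := by
  have hU := hH.eigenvectorUnitary.2
  have h : NormedSpace.exp (-(β : ℂ) • H) = evolve (hH.eigenvectorUnitary : Matrix a a ℂ)
      (rdiag fun i => Real.exp (-β * hH.eigenvalues i)) := by
    conv_lhs => rw [eq_evolve_eigenvalues hH]
    generalize (hH.eigenvectorUnitary : Matrix a a ℂ) = U at hU
    have hinv : Uᴴ = U⁻¹ :=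
      (Matrix.inv_eq_right_inv (mul_conjTranspose_of_unitary hU)).symm
    have hun : IsUnit U := IsUnit.of_mul_eq_one _ (mul_conjTranspose_of_unitary hU)
    rw [evolve, evolve, hinv, ← Matrix.smul_mul, ← Matrix.mul_smul, Matrix.exp_conj _ _ hun]
    congr 2
    rw [rdiag, rdiag, ← Matrix.diagonal_smul, Matrix.exp_diagonal]
    congr 1
    ext i
    rw [Pi.coe_exp]
    simp [Complex.exp_eq_exp_ℂ]
  rw [thermal, h, trace_eq_sum_of_evolve hU]
  have : ∀ (c : ℂ) (U X : Matrix a a ℂ), c • evolve U X = evolve U (c • X) := by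
    intros; simp [evolve]
  rw [this]
  congr 1
  rw [rdiag, rdiag, ← Matrix.diagonal_smul]
  congr 1
  ext i
  simp only [Pi.smul_apply, smul_eq_mul]
  push_cast
  ring

lemma thermal_isState [Nonempty a] (hH : H.IsHermitian) : IsState (thermal β H) := by
  have hU := hH.eigenvectorUnitary.2
  have hZ : 0 < ∑ j, Real.exp (-β * hH.eigenvalues j) :=
    Finset.sum_pos (fun _ _ => Real.exp_pos _) Finset.univ_nonempty
  rw [thermal_eq hH]
  refine ⟨?_, ?_⟩
  · refine Matrix.PosSemidef.mul_mul_conjTranspose_same (Matrix.PosSemidef.diagonal fun i => ?_) _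
    simp only [Pi.zero_apply, Complex.zero_le_real]
    positivity
  · rw [trace_eq_sum_of_evolve hU, ← Finset.sum_div, div_self hZ.ne', Complex.ofReal_one]

lemma partitionFn_smul (hH : H.IsHermitian) :
    partitionFn ((-β : ℂ) • H) = ∑ j, Real.exp (-β * hH.eigenvalues j) := by
  have hU := hH.eigenvectorUnitary.2
  have h : (-β : ℂ) • H = evolve (hH.eigenvectorUnitary : Matrix a a ℂ)
      (rdiag fun j => -β * hH.eigenvalues j) := by
    conv_lhs => rw [eq_evolve_eigenvalues hH]
    rw [evolve, evolve, ← Matrix.smul_mul, ← Matrix.mul_smul, rdiag, rdiag, ← Matrix.diagonal_smul]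
    congr 3
    ext i
    simp
  rw [h, partitionFn, spectralTrace_evolve_rdiag _ hU]

/-- The thermal state minimizes the free energy. -/
theorem freeEnergy_thermal_le (hβ : 0 < β) (hH : H.IsHermitian) {σ : Matrix a a ℂ}
    (hσ : IsState σ) : freeEnergy β H (thermal β H) ≤ freeEnergy β H σ := by
  have := hσ.nonempty
  have hU := hH.eigenvectorUnitary.2
  have hZ : 0 < ∑ j, Real.exp (-β * hH.eigenvalues j) :=
    Finset.sum_pos (fun _ _ => Real.exp_pos _) Finset.univ_nonempty
  have hβH : ((-β : ℂ) • H).IsHermitian := by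
    simp [Matrix.IsHermitian, Matrix.conjTranspose_smul, hH.eq]
  have h1 := entropy_le hσ hβH
  have hE : ∀ X, expect ((-β : ℂ) • H) X = -β * expect H X := fun X => by
    simp [expect]
  rw [hE, partitionFn_smul hH] at h1
  have hst : IsState (thermal β H) := thermal_isState hH
  have h2 : entropy (thermal β H)
      = Real.log (∑ j, Real.exp (-β * hH.eigenvalues j)) + β * expect H (thermal β H) := by
    have hexp : expect H (thermal β H) = ∑ i, hH.eigenvalues i
        * (Real.exp (-β * hH.eigenvalues i) / ∑ j, Real.exp (-β * hH.eigenvalues j)) := by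
      rw [thermal_eq hH]
      conv_lhs => enter [1]; rw [eq_evolve_eigenvalues hH]
      rw [expect_evolve_rdiag, conjTranspose_mul_of_unitary hU]
      refine Finset.sum_congr rfl fun j _ => ?_
      rw [Finset.sum_eq_single j] <;> simp +contextual [eq_comm]
    have hone : ∑ i, Real.exp (-β * hH.eigenvalues i)
        / ∑ j, Real.exp (-β * hH.eigenvalues j) = 1 := by
      rw [← Finset.sum_div, div_self hZ.ne']
    rw [hexp]
    conv_lhs => rw [thermal_eq hH, entropy_evolve_rdiag hU]
    generalize ∑ j, Real.exp (-β * hH.eigenvalues j) = Z at *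
    have hterm : ∀ i, Real.negMulLog (Real.exp (-β * hH.eigenvalues i) / Z)
        = (Real.exp (-β * hH.eigenvalues i) / Z) * Real.log Z
          + β * (hH.eigenvalues i * (Real.exp (-β * hH.eigenvalues i) / Z)) := fun i => by
      rw [Real.negMulLog, Real.log_div (Real.exp_ne_zero _) hZ.ne', Real.log_exp]; ring
    simp only [hterm, Finset.sum_add_distrib, ← Finset.sum_mul, ← Finset.mul_sum, hone, one_mul]
  unfold freeEnergy
  have h3 : expect H (thermal β H) - entropy (thermal β H) / β
      = -Real.log (∑ j, Real.exp (-β * hH.eigenvalues j)) / β := by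
    rw [h2]; field_simp; ring
  have h4 : entropy σ / β
      ≤ Real.log (∑ j, Real.exp (-β * hH.eigenvalues j)) / β + expect H σ := by
    rw [div_add' _ _ _ hβ.ne']; gcongr; linarith
  rw [h3, neg_div]
  linarith

end Thermal

/-! ### Work of processes with a thermal bath -/

/-- The energy supplied to a system in state `ρ` and a thermal bath by a process with final joint
state `X`: since the thermal state minimizes the free energy, the energy taken up by the bath is at
least `β⁻¹` times its entropy change. -/
theorem bath_work_ge {β : ℝ} (hβ : 0 < β) (H : Matrix a a ℂ) {K : Matrix b b ℂ} (hK : K.IsHermitian)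
    {ρ : Matrix a a ℂ} (hρ : IsState ρ) {X : Matrix (a × b) (a × b) ℂ} (hX : IsState X) :
    expect H (trSnd X) - expect H ρ + (entropy (trFst X) - entropy (thermal β K)) / β
      ≤ expect (jointH H K) (X - ρ ⊗ₖ thermal β K) := by
  have := hX.trFst.nonempty
  have hγ : IsState (thermal β K) := thermal_isState hK
  have h := freeEnergy_thermal_le hβ hK hX.trFst
  rw [expect_sub, expect_jointH, expect_jointH, trSnd_kronecker, trFst_kronecker, hγ.trace_eq_one,
    hρ.trace_eq_one, one_smul, one_smul, sub_div]
  unfold freeEnergy at h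
  linarith

/-- The work of a unitary on a system in state `ρ` and a thermal bath is at least the free energy
change of the system. -/
theorem unitaryWork_bath_ge {β : ℝ} (hβ : 0 < β) (H : Matrix a a ℂ) {K : Matrix b b ℂ}
    (hK : K.IsHermitian) [Nonempty b] {ρ : Matrix a a ℂ} (hρ : IsState ρ)
    {U : Matrix (a × b) (a × b) ℂ} (hU : U ∈ Matrix.unitaryGroup (a × b) ℂ) :
    freeEnergy β H (trSnd (evolve U (ρ ⊗ₖ thermal β K))) - freeEnergy β H ρ
      ≤ unitaryWork (jointH H K) U (ρ ⊗ₖ thermal β K) := by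
  have hγ : IsState (thermal β K) := thermal_isState hK
  have hX := (hρ.kronecker hγ).evolve hU
  have h1 := bath_work_ge hβ H hK hρ hX
  have h2 := entropy_subadditive hX
  rw [entropy_evolve hU (hρ.kronecker hγ).isHermitian, entropy_kronecker hρ hγ] at h2
  have h3 : (entropy ρ - entropy (trSnd (evolve U (ρ ⊗ₖ thermal β K)))) / β
      ≤ (entropy (trFst (evolve U (ρ ⊗ₖ thermal β K))) - entropy (thermal β K)) / β := by
    rw [div_le_div_iff_of_pos_right hβ]; linarith
  rw [sub_div] at h3
  unfold freeEnergy unitaryWork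
  linarith

/-! ### The measurement step -/

variable {s m κ : Type*} [Fintype s] [DecidableEq s] [Fintype m] [DecidableEq m] [Fintype κ]

namespace Device

variable (D : Device s m κ)

/-- The projection `1 ⊗ Q_k` on the joint system of `s` and the memory. -/
def proj (k : κ) : Matrix (s × m) (s × m) ℂ := (1 : Matrix s s ℂ) ⊗ₖ D.Q k

lemma proj_isHermitian (k : κ) : (D.proj k).IsHermitian := by
  rw [proj, Matrix.IsHermitian, Matrix.conjTranspose_kronecker, (D.Q_herm k).eq,
    Matrix.conjTranspose_one]

lemma proj_idem (k : κ) : D.proj k * D.proj k = D.proj k := by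
  rw [proj, ← Matrix.mul_kronecker_mul, D.Q_idem, one_mul]

lemma proj_sum : ∑ k, D.proj k = 1 := by
  have h : ∑ k, D.proj k = (1 : Matrix s s ℂ) ⊗ₖ ∑ k, D.Q k := by
    ext i j
    simp [proj, Matrix.sum_apply, Finset.mul_sum]
  rw [h, D.Q_sum, Matrix.one_kronecker_one]

lemma Q_mul_Q {k l : κ} (h : k ≠ l) : D.Q k * D.Q l = 0 :=
  mul_eq_zero_of_sum_eq_one D.Q_herm D.Q_idem D.Q_sum h

variable {D} {T : Measurement s κ} {ρ : Matrix s s ℂ}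

lemma evolve_isState (hρ : IsState ρ) : IsState (evolve D.U (ρ ⊗ₖ D.mem)) :=
  (hρ.kronecker D.mem_state).evolve D.unitary

lemma postJoint_isState (hρ : IsState ρ) : IsState (D.postJoint ρ) :=
  pinching_isState D.proj_isHermitian D.proj_idem D.proj_sum (evolve_isState hρ)

lemma postMem_isState (hρ : IsState ρ) : IsState (D.postMem ρ) := (postJoint_isState hρ).trFst

lemma trSnd_postJoint (hD : D.Implements T) (hρ : IsState ρ) :
    trSnd (D.postJoint ρ) = T.post ρ := by
  rw [postJoint, trSnd_sum, Measurement.post]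
  exact Finset.sum_congr rfl fun k _ => hD ρ hρ k

lemma post_isState (hD : D.Implements T) (hρ : IsState ρ) : IsState (T.post ρ) := by
  rw [← trSnd_postJoint hD hρ]; exact (postJoint_isState hρ).trSnd

/-- The measurement step does not decrease the entropy of the joint system. -/
lemma entropy_add_le_postJoint (hρ : IsState ρ) :
    entropy ρ + entropy D.mem ≤ entropy (D.postJoint ρ) := by
  have h := entropy_le_pinching D.proj_isHermitian D.proj_idem D.proj_sum
    (evolve_isState (D := D) hρ)
  rwa [entropy_evolve D.unitary (hρ.kronecker D.mem_state).isHermitian,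
    entropy_kronecker hρ D.mem_state] at h

lemma commute_proj_jointH (HS : Matrix s s ℂ) {HM : Matrix m m ℂ} (hQ : ∀ k, Commute (D.Q k) HM)
    (k : κ) : Commute (D.proj k) (jointH HS HM) := by
  rw [Commute, SemiconjBy, proj, jointH]
  simp only [mul_add, add_mul, ← Matrix.mul_kronecker_mul, one_mul, mul_one, (hQ k).eq]

/-- As the readout projections commute with the Hamiltonian of the memory, the projective readout
costs no energy on average. -/
theorem measWork_eq_measEnergy (HS : Matrix s s ℂ) {HM : Matrix m m ℂ}
    (hQ : ∀ k, Commute (D.Q k) HM) (hD : D.Implements T) (hρ : IsState ρ) :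
    measWork HS HM D ρ = measEnergy HS HM T D ρ := by
  have h := pinching_expect D.proj_idem D.proj_sum (commute_proj_jointH HS hQ)
    (evolve D.U (ρ ⊗ₖ D.mem))
  have h' : expect (jointH HS HM) (D.postJoint ρ)
      = expect (jointH HS HM) (evolve D.U (ρ ⊗ₖ D.mem)) := h
  rw [measWork, unitaryWork, expect_sub, ← h', expect_jointH, expect_jointH, trSnd_postJoint hD hρ,
    trSnd_kronecker, trFst_kronecker, hρ.trace_eq_one, D.mem_state.trace_eq_one, one_smul, one_smul,
    measEnergy, expect_sub, expect_sub, postMem]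
  ring

end Device

/-! ### Outcome-dependent operations as one controlled unitary -/

/-- The rearrangement of tensor factors that moves the memory `m` behind the bath `b`. -/
def memLast (s m b : Type*) : (s × b) × m ≃ (s × m) × b where
  toFun p := ((p.1.1, p.2), p.1.2)
  invFun p := ((p.1.1, p.2), p.1.2)

namespace Device

/-- The joint unnormalised state of system, bath and memory for outcome `k`, the bath being in the
state `γ`. -/
def bathBranch (D : Device s m κ) (γ : Matrix b b ℂ) (ρ : Matrix s s ℂ) (k : κ) :
    Matrix ((s × b) × m) ((s × b) × m) ℂ :=
  (D.branch ρ k ⊗ₖ γ).submatrix (memLast s m b) (memLast s m b)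

/-- The unitary `∑_k V_k ⊗ Q_k`, which applies `V_k` to system and bath if the memory holds `k`. -/
def controlled (D : Device s m κ) (V : κ → Matrix (s × b) (s × b) ℂ) :
    Matrix ((s × b) × m) ((s × b) × m) ℂ := ∑ k, V k ⊗ₖ D.Q k

variable {D : Device s m κ} {T : Measurement s κ} {ρ : Matrix s s ℂ} {γ : Matrix b b ℂ}
  {V : κ → Matrix (s × b) (s × b) ℂ}

lemma controlled_mem_unitaryGroup (hV : ∀ k, V k ∈ Matrix.unitaryGroup (s × b) ℂ) :
    D.controlled V ∈ Matrix.unitaryGroup ((s × b) × m) ℂ := by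
  classical
  rw [Matrix.mem_unitaryGroup_iff, Matrix.star_eq_conjTranspose, controlled,
    Matrix.conjTranspose_sum, Finset.sum_mul_sum]
  have h : ∀ k l, V k ⊗ₖ D.Q k * (V l ⊗ₖ D.Q l)ᴴ
      = if k = l then (1 : Matrix (s × b) (s × b) ℂ) ⊗ₖ D.Q k else 0 := fun k l => by
    rw [Matrix.conjTranspose_kronecker, ← Matrix.mul_kronecker_mul, (D.Q_herm l).eq]
    split_ifs with hkl
    · subst hkl; rw [mul_conjTranspose_of_unitary (hV k), D.Q_idem]
    · rw [D.Q_mul_Q hkl, Matrix.kronecker_zero]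
  simp only [h, Finset.sum_ite_eq, Finset.mem_univ, if_true]
  have h2 : ∑ k, (1 : Matrix (s × b) (s × b) ℂ) ⊗ₖ D.Q k
      = (1 : Matrix (s × b) (s × b) ℂ) ⊗ₖ ∑ k, D.Q k := by
    ext i j
    simp [Matrix.sum_apply, Finset.mul_sum]
  rw [h2, D.Q_sum, Matrix.one_kronecker_one]

lemma one_kronecker_Q_eq (k : κ) : (1 : Matrix (s × b) (s × b) ℂ) ⊗ₖ D.Q k
    = (D.proj k ⊗ₖ (1 : Matrix b b ℂ)).submatrix (memLast s m b) (memLast s m b) := by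
  ext ⟨⟨i, j⟩, l⟩ ⟨⟨i', j'⟩, l'⟩
  simp only [Matrix.kroneckerMap_apply, Matrix.submatrix_apply, proj, memLast, Equiv.coe_fn_mk,
    Matrix.one_apply, Prod.mk.injEq]
  split_ifs <;> simp_all

lemma proj_mul_proj {k l : κ} (h : k ≠ l) : D.proj k * D.proj l = 0 :=
  mul_eq_zero_of_sum_eq_one D.proj_isHermitian D.proj_idem D.proj_sum h

open Classical in
lemma Q_mul_bathBranch (l k : κ) :
    ((1 : Matrix (s × b) (s × b) ℂ) ⊗ₖ D.Q l) * D.bathBranch γ ρ k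
      = if l = k then D.bathBranch γ ρ k else 0 := by
  have h : D.branch ρ k = D.proj k * evolve D.U (ρ ⊗ₖ D.mem) * D.proj k := rfl
  rw [one_kronecker_Q_eq, bathBranch, Matrix.submatrix_mul_equiv, ← Matrix.mul_kronecker_mul, one_mul,
    h, ← mul_assoc, ← mul_assoc]
  split_ifs with hlk
  · rw [hlk, D.proj_idem]
  · rw [proj_mul_proj hlk]; simp

open Classical in
lemma bathBranch_mul_Q (l k : κ) :
    D.bathBranch γ ρ k * ((1 : Matrix (s × b) (s × b) ℂ) ⊗ₖ D.Q l)
      = if l = k then D.bathBranch γ ρ k else 0 := by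
  have h : D.branch ρ k = D.proj k * evolve D.U (ρ ⊗ₖ D.mem) * D.proj k := rfl
  rw [one_kronecker_Q_eq, bathBranch, Matrix.submatrix_mul_equiv, ← Matrix.mul_kronecker_mul, mul_one,
    h, mul_assoc]
  split_ifs with hlk
  · rw [hlk, D.proj_idem]
  · rw [proj_mul_proj (Ne.symm hlk)]; simp

/-- On the branch of outcome `k` the controlled unitary acts as `V_k` on system and bath. -/
lemma evolve_controlled_bathBranch (k : κ) :
    evolve (D.controlled V) (D.bathBranch γ ρ k)
      = (V k ⊗ₖ (1 : Matrix m m ℂ)) * D.bathBranch γ ρ k * ((V k)ᴴ ⊗ₖ (1 : Matrix m m ℂ)) := by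
  classical
  have h1 : D.controlled V = ∑ l, (V l ⊗ₖ (1 : Matrix m m ℂ)) *
      ((1 : Matrix (s × b) (s × b) ℂ) ⊗ₖ D.Q l) := by
    simp only [controlled, ← Matrix.mul_kronecker_mul, mul_one, one_mul]
  have h2 : (D.controlled V)ᴴ = ∑ l, ((1 : Matrix (s × b) (s × b) ℂ) ⊗ₖ D.Q l) *
      ((V l)ᴴ ⊗ₖ (1 : Matrix m m ℂ)) := by
    simp only [controlled, ← Matrix.mul_kronecker_mul, mul_one, one_mul, Matrix.conjTranspose_sum,
      Matrix.conjTranspose_kronecker, (D.Q_herm _).eq]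
  have h3 : D.controlled V * D.bathBranch γ ρ k
      = (V k ⊗ₖ (1 : Matrix m m ℂ)) * D.bathBranch γ ρ k := by
    rw [h1, Finset.sum_mul]
    simp only [mul_assoc, Q_mul_bathBranch]
    simp
  have h4 : D.bathBranch γ ρ k * (D.controlled V)ᴴ
      = D.bathBranch γ ρ k * ((V k)ᴴ ⊗ₖ (1 : Matrix m m ℂ)) := by
    rw [h2, Finset.mul_sum]
    simp only [← mul_assoc, bathBranch_mul_Q]
    simp
  rw [evolve, h3, mul_assoc, h4, ← mul_assoc]

lemma trSnd_bathBranch (k : κ) : trSnd (D.bathBranch γ ρ k) = trSnd (D.branch ρ k) ⊗ₖ γ := by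
  ext ⟨i, j⟩ ⟨i', j'⟩
  simp [trSnd, bathBranch, memLast, Finset.sum_mul]

lemma trFst_bathBranch (k : κ) (hγ : γ.trace = 1) :
    trFst (D.bathBranch γ ρ k) = trFst (D.branch ρ k) := by
  ext i j
  simp only [Matrix.trace, Matrix.diag_apply] at hγ
  simp [trFst, bathBranch, memLast, Fintype.sum_prod_type, ← Finset.mul_sum, hγ]

lemma sum_bathBranch : ∑ k, D.bathBranch γ ρ k
    = (D.postJoint ρ ⊗ₖ γ).submatrix (memLast s m b) (memLast s m b) := by
  ext i j
  simp [bathBranch, postJoint, Matrix.sum_apply, Finset.sum_mul]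

lemma evolve_sum {κ : Type*} [Fintype κ] (U : Matrix a a ℂ) (X : κ → Matrix a a ℂ) :
    evolve U (∑ k, X k) = ∑ k, evolve U (X k) := by
  simp [evolve, Finset.mul_sum, Finset.sum_mul]

lemma trSnd_evolve_controlled (hD : D.Implements T) (hρ : IsState ρ) :
    trSnd (evolve (D.controlled V) (∑ k, D.bathBranch γ ρ k))
      = ∑ k, evolve (V k) (T.op k ρ ⊗ₖ γ) := by
  rw [evolve_sum, trSnd_sum]
  refine Finset.sum_congr rfl fun k _ => ?_
  rw [evolve_controlled_bathBranch, trSnd_mul_mul, trSnd_bathBranch, hD ρ hρ k]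
  rfl

lemma trFst_evolve_controlled (hV : ∀ k, V k ∈ Matrix.unitaryGroup (s × b) ℂ) (hγ : γ.trace = 1) :
    trFst (evolve (D.controlled V) (∑ k, D.bathBranch γ ρ k)) = D.postMem ρ := by
  rw [evolve_sum, trFst_sum, postMem, postJoint, trFst_sum]
  refine Finset.sum_congr rfl fun k _ => ?_
  rw [evolve_controlled_bathBranch, trFst_mul_mul _ _ _ (conjTranspose_mul_of_unitary (hV k)),
    trFst_bathBranch k hγ]

lemma feedback_isState (hD : D.Implements T) (hρ : IsState ρ) (hγ : IsState γ)
    (hV : ∀ k, V k ∈ Matrix.unitaryGroup (s × b) ℂ) :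
    IsState (∑ k, evolve (V k) (T.op k ρ ⊗ₖ γ)) := by
  rw [← trSnd_evolve_controlled hD hρ, sum_bathBranch]
  exact ((((postJoint_isState hρ).kronecker hγ).submatrix _).evolve
    (controlled_mem_unitaryGroup hV)).trSnd

/-- The entropy balance of measurement and feedback. Feedback is the controlled unitary on system,
bath and memory; it preserves the joint entropy and leaves the average memory state unchanged, so
the claim is subadditivity of the final joint state. -/
theorem entropy_add_le_feedback (hD : D.Implements T) (hρ : IsState ρ) (hγ : IsState γ)
    (hV : ∀ k, V k ∈ Matrix.unitaryGroup (s × b) ℂ) :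
    entropy ρ + entropy D.mem + entropy γ
      ≤ entropy (∑ k, evolve (V k) (T.op k ρ ⊗ₖ γ)) + entropy (D.postMem ρ) := by
  have hJ := (postJoint_isState (D := D) hρ).kronecker hγ
  have hY := hJ.submatrix (memLast s m b)
  have hW := controlled_mem_unitaryGroup (D := D) hV
  have h := entropy_subadditive (hY.evolve hW)
  rw [entropy_evolve hW hY.isHermitian, entropy_submatrix _ hJ.isHermitian,
    entropy_kronecker (postJoint_isState hρ) hγ, ← sum_bathBranch, trSnd_evolve_controlled hD hρ,
    trFst_evolve_controlled hV hγ.trace_eq_one] at h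
  linarith [entropy_add_le_postJoint (D := D) hρ]

lemma sum_unitaryWork (H : Matrix s s ℂ) (K : Matrix b b ℂ) :
    ∑ k, unitaryWork (jointH H K) (V k) (T.op k ρ ⊗ₖ γ)
      = expect (jointH H K) (∑ k, evolve (V k) (T.op k ρ ⊗ₖ γ) - T.post ρ ⊗ₖ γ) := by
  have h : T.post ρ ⊗ₖ γ = ∑ k, T.op k ρ ⊗ₖ γ := by
    ext i j
    simp [Measurement.post, Matrix.sum_apply, Finset.sum_mul]
  rw [h, ← Finset.sum_sub_distrib, expect_sum]
  rfl

end Device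

/-! ### Second Law and full cycle -/

variable {β : ℝ} {HS : Matrix s s ℂ} {HM : Matrix m m ℂ} {D : Device s m κ} {T : Measurement s κ}
  {ρ : Matrix s s ℂ}

/-- Resetting the memory costs at least the free energy it gained. Lower semicontinuity of the free
energy covers resets that are only approached. -/
theorem neg_deltaFM_le_of_isResetWork (hβ : 0 < β) (hρ : IsState ρ) {w : ℝ}
    (hw : IsResetWork β HM D ρ w) : -deltaFM β HM D ρ ≤ w := by
  refine le_of_forall_pos_lt_add fun δ hδ => ?_
  obtain ⟨ε, hε, hF⟩ := exists_freeEnergy_gt hβ HM D.mem_state (half_pos hδ)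
  obtain ⟨n, HB, U, hHB, hU, hclose, hwork⟩ := hw (min ε (δ / 2)) (lt_min hε (half_pos hδ))
  have hM := Device.postMem_isState (D := D) hρ
  have hγ : IsState (thermal β HB) := thermal_isState hHB
  have h1 := unitaryWork_bath_ge hβ HM hHB hM hU
  have h2 := hF _ ((hM.kronecker hγ).evolve hU).trSnd
    fun i j => (hclose i j).trans_le (min_le_left _ _)
  have h3 := (abs_lt.1 (hwork.trans_le (min_le_right _ _))).2
  unfold deltaFM
  linarith

/-- The work of restoring the measured system, with feedback, is at least `-ΔE_S - ΔS_M / β`, where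
`ΔE_S` is the energy change of the system and `ΔS_M` the entropy change of the memory in the
measurement. This can be less than `-ΔF_S`: the outcome stored in the memory is a resource, but the
same entropy `ΔS_M` has to be paid for in the reset. -/
theorem le_of_isRestoreWork (hβ : 0 < β) (hD : D.Implements T) (hρ : IsState ρ) {w : ℝ}
    (hw : IsRestoreWork β HS T ρ w) :
    expect HS ρ - expect HS (T.post ρ) + (entropy D.mem - entropy (D.postMem ρ)) / β ≤ w := by
  refine le_of_forall_pos_lt_add fun δ hδ => ?_
  obtain ⟨ε, hε, hF⟩ := exists_freeEnergy_gt hβ HS hρ (half_pos hδ)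
  obtain ⟨n, HB, V, hHB, hV, hclose, hwork⟩ := hw (min ε (δ / 2)) (lt_min hε (half_pos hδ))
  have hγ : IsState (thermal β HB) := thermal_isState hHB
  have hX := Device.feedback_isState hD hρ hγ hV
  have h1 := bath_work_ge hβ HS hHB (Device.post_isState hD hρ) hX
  rw [← Device.sum_unitaryWork] at h1
  rw [← trSnd_sum] at hclose
  have h2 := hF _ hX.trSnd fun i j => (hclose i j).trans_le (min_le_left _ _)
  have h3 := (abs_lt.1 (hwork.trans_le (min_le_right _ _))).2
  have h4 := Device.entropy_add_le_feedback hD hρ hγ hV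
  have h5 := entropy_subadditive hX
  generalize ∑ k, evolve (V k) (T.op k ρ ⊗ₖ thermal β HB) = X at *
  have h6 : (entropy ρ + entropy D.mem - entropy (D.postMem ρ) - entropy (trSnd X)) / β
      ≤ (entropy (trFst X) - entropy (thermal β HB)) / β := by
    rw [div_le_div_iff_of_pos_right hβ]; linarith
  unfold freeEnergy at h2
  simp only [sub_div, add_div] at h6 h1 ⊢
  linarith

end QMeas

theorem mainTheorem9 {s m κ : Type*} [Fintype s] [DecidableEq s] [Fintype m] [DecidableEq m]
    [Fintype κ] (β : ℝ) (hβ : 0 < β)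
    (HS : Matrix s s ℂ) (hHS : HS.IsHermitian) (HM : Matrix m m ℂ) (hHM : HM.IsHermitian)
    (T : QMeas.Measurement s κ) (D : QMeas.Device s m κ) (hD : D.Implements T)
    (hQ : ∀ k, Commute (D.Q k) HM)
    (ρ : Matrix s s ℂ) (hρ : QMeas.IsState ρ) :
    QMeas.measWork HS HM D ρ = QMeas.measEnergy HS HM T D ρ ∧
    ∀ WR : ℝ, (QMeas.IsResetWork β HM D ρ WR ∨ WR = -QMeas.deltaFM β HM D ρ) →
      QMeas.measWork HS HM D ρ + WR ≥ QMeas.deltaFS β HS T ρ ∧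
      ∀ WX : ℝ, (QMeas.IsRestoreWork β HS T ρ WX ∨ WX = -QMeas.deltaFS β HS T ρ) →
        0 ≤ QMeas.measWork HS HM D ρ + WR + WX := by
  have hW := QMeas.Device.measWork_eq_measEnergy HS hQ hD hρ
  refine ⟨hW, fun WR hWR => ?_⟩
  have hR : -QMeas.deltaFM β HM D ρ ≤ WR := by
    rcases hWR with h | h
    · exact QMeas.neg_deltaFM_le_of_isResetWork hβ hρ h
    · exact h.ge
  -- the energy of the memory cancels between measurement and reset
  have hcost : QMeas.expect HS (T.post ρ) - QMeas.expect HS ρ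
      + (QMeas.entropy (D.postMem ρ) / β - QMeas.entropy D.mem / β)
      ≤ QMeas.measWork HS HM D ρ + WR := by
    rw [hW, QMeas.measEnergy, QMeas.expect_sub, QMeas.expect_sub]
    unfold QMeas.deltaFM QMeas.freeEnergy at hR
    linarith
  have hsecond : QMeas.measWork HS HM D ρ + WR ≥ QMeas.deltaFS β HS T ρ := by
    have h1 := QMeas.entropy_subadditive (QMeas.Device.postJoint_isState (D := D) hρ)
    rw [QMeas.Device.trSnd_postJoint hD hρ] at h1
    have h2 := QMeas.Device.entropy_add_le_postJoint (D := D) hρ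
    have h3 : (QMeas.entropy ρ + QMeas.entropy D.mem) / β
        ≤ (QMeas.entropy (T.post ρ) + QMeas.entropy (D.postMem ρ)) / β := by
      rw [div_le_div_iff_of_pos_right hβ]; exact h2.trans h1
    rw [add_div, add_div] at h3
    unfold QMeas.deltaFS QMeas.freeEnergy
    linarith
  refine ⟨hsecond, fun WX hWX => ?_⟩
  rcases hWX with h | h
  · have h4 := QMeas.le_of_isRestoreWork (HS := HS) hβ hD hρ h
    rw [sub_div] at h4
    linarith
  · linarith
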